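/- Let $m\ge 2$ be an integer and let $G=\langle a,b \mid {}_m(a,b)={}_m(b,a)\rangle$, where ${}_n(x,y)$ denotes the alternating product $xyx\cdots$ of $n$ factors starting with $x$; let $\Delta={}_m(a,b)$. The \emph{Garside generators} of $G$ are the alternating products ${}_n(a,b)$, ${}_n(b,a)$ with $1\le n<m$, together with $\Delta$. \textbf{The complex $\mathcal X$.} For each $g\in G$ the precell $\Pi_g$ is the circuit of length $2m$ in the Cayley graph of $G$ over $\{a,b\}$ that is formed by the two half boundaries, from $g$ (the initial vertex) to $g\Delta$ (the terminal vertex), with vertices $g\cdot{}_j(a,b)$ and $g\cdot{}_j(b,a)$, $0\le j\le m$. Each precell is triangulated: $m-2$ interior vertices $c_1,\dots,c_{m-2}$ are added, and, with $c_0=g$ and $c_{m-1}=g\Delta$, interior edges $\{c_i,c_{i+1}\}$ for $0\le i\le m-2$, and, for $1\le i\le m-2$, interior edges from $c_i$ to the vertices in positions $i$ and $i+1$ of both half boundaries. If a final segment with $k$ edges, $2\le k<m$, of a half boundary of $\Pi_g$ is an initial segment of a half boundary of $\Pi_h$, then the edges of the zigzag path $x_1y_1x_2y_2\cdots x_{k-1}y_{k-1}$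 are added, where $x_t$ is the interior vertex $c_{m-k-1+t}$ of $\Pi_g$ and $y_t$ is the interior vertex $c_t$ of $\Pi_h$. Finally $\mathcal X$ is the flag complex of the graph that consists of the Cayley graph and all these vertices and edges. The elements of $G$ are the real vertices of $\mathcal X$, and the edges of the Cayley graph are its real edges. $G$ acts on $\mathcal X$ by left multiplication on the real vertices and on the precells. Let $v_0$ be the identity vertex and $\Pi_0=\Pi_1$ the precell with initial vertex $v_0$. \textbf{Labels and alphabets.} Let $V_0$ be a set of representatives of the $G$-orbits of simplices of $\mathcal X$, and write $\bar\sigma\in V_0$ for the representative of the orbit of $\sigma$. Put $\Lambda_\sigma=\{g\in G:\sigma=g\bar\sigma\}$ and $\Lambda_{\sigma,\tau}=\Lambda_\sigma^{-1}\Lambda_\tau$. Let $\mathcal B\subseteq G$ be the union of the stabiliser $G_{v_0}$ and all $\Lambda_{\sigma,\tau}$ with $\sigma,\tau$ simplices related by inclusion or reverse inclusion, and let $\mathcal A\subseteq G$ be the union of $G_{v_0}$ and all $\Lambda_{\rho,\tau}$ with $\rho,\tau$ disjoint simplices that together span a simplex. \textbf{Proposition.} Suppose that $V_0$ is based on $\Pi_0$,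 that is: (1) $V_0$ contains $v_0$ and the two real edges $\{v_0,av_0\}$, $\{v_0,bv_0\}$; (2) $V_0$ contains all interior vertices and all interior edges of $\Pi_0$; (3) every simplex in $V_0$ contains $v_0$ or an interior vertex of $\Pi_0$. Then each of $\mathcal A$ and $\mathcal B$ is exactly the set of all Garside generators of $G$, their inverses, and the identity element. -/

import Mathlib

open scoped Pointwise

/-! ### Labels and the alphabets of a group acting on a simplicial complex -/

namespace GroupComplex

variable {V : Type*} [DecidableEq V] {G : Type*} [Group G] [MulAction G V]

/-- `V₀` is a set of representatives of the `G`-orbits of simplices of `X`. -/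
structure IsOrbitReps (G : Type*) [Group G] [MulAction G V]
    (X : AbstractSimplicialComplex V) (V₀ : Set (Finset V)) : Prop where
  subset : V₀ ⊆ X.faces
  existsUnique : ∀ σ ∈ X.faces, ∃! τ : Finset V, τ ∈ V₀ ∧ ∃ g : G, σ = g • τ

/-- The set `Λ_σ` of labels of `σ`: all `g` with `σ = g • σ̄`, where `σ̄` is the representative
of the orbit of `σ` in `V₀`. -/
def labels (G : Type*) [Group G] [MulAction G V] (V₀ : Set (Finset V)) (σ : Finset V) : Set G :=
  {g | ∃ τ ∈ V₀, σ = g • τ}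

/-- The set `Λ_{σ,τ} = Λ_σ⁻¹ Λ_τ` of labels of a pair of simplices. -/
def pairLabels (G : Type*) [Group G] [MulAction G V] (V₀ : Set (Finset V)) (σ τ : Finset V) :
    Set G :=
  (labels G V₀ σ)⁻¹ * labels G V₀ τ

/-- The alphabet `𝒜`: the stabiliser of `v₀` together with all `Λ_{ρ,τ}` for which `ρ`, `τ` are
disjoint simplices that together span a simplex. -/
def alphabetA (G : Type*) [Group G] [MulAction G V]
    (X : AbstractSimplicialComplex V) (V₀ : Set (Finset V)) (v₀ : V) : Set G :=
  {g | g • v₀ = v₀} ∪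
    {g | ∃ ρ ∈ X.faces, ∃ τ ∈ X.faces, Disjoint ρ τ ∧ ρ ∪ τ ∈ X.faces ∧ g ∈ pairLabels G V₀ ρ τ}

/-- The alphabet `ℬ`: the stabiliser of `v₀` together with all `Λ_{σ,τ}` for which the simplices
`σ`, `τ` are related by inclusion or reverse inclusion. -/
def alphabetB (G : Type*) [Group G] [MulAction G V]
    (X : AbstractSimplicialComplex V) (V₀ : Set (Finset V)) (v₀ : V) : Set G :=
  {g | g • v₀ = v₀} ∪
    {g | ∃ σ ∈ X.faces, ∃ τ ∈ X.faces, (σ ⊆ τ ∨ τ ⊆ σ) ∧ g ∈ pairLabels G V₀ σ τ}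

/-- The flag complex of a graph: its simplices are the nonempty finite cliques. -/
def flagComplex (Γ : SimpleGraph V) : AbstractSimplicialComplex V where
  faces := {σ | σ.Nonempty ∧ Γ.IsClique (σ : Set V)}
  isRelLowerSet_faces := fun _ h =>
    ⟨h.1, fun _ hle hne => ⟨hne, h.2.subset (Finset.coe_subset.mpr hle)⟩⟩
  singleton_mem v := ⟨Finset.singleton_nonempty v, by simp⟩

end GroupComplex

/-! ### The dihedral Artin group -/

/-- The alternating product `ₙ(x,y) = x y x ⋯` of `n` factors starting with `x`. -/
def altProd {M : Type*} [Monoid M] (x y : M) : ℕ → M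
  | 0 => 1
  | n + 1 => x * altProd y x n

/-- The group `⟨a, b ∣ ₘ(a,b) = ₘ(b,a)⟩`, with `a` and `b` indexed by `false` and `true`. -/
abbrev DihedralArtin (m : ℕ) : Type :=
  PresentedGroup ({altProd (FreeGroup.of false) (FreeGroup.of true) m *
    (altProd (FreeGroup.of true) (FreeGroup.of false) m)⁻¹} : Set (FreeGroup Bool))

namespace DihedralArtin

variable {m : ℕ}

/-- The standard generators: `gen false = a`, `gen true = b`. -/
def gen (s : Bool) : DihedralArtin m := PresentedGroup.of s

/-- The alternating product of `n` standard generators starting with `gen s`. -/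
def alt (s : Bool) (n : ℕ) : DihedralArtin m := altProd (gen s) (gen !s) n

/-- The element `Δ = ₘ(a,b)`. -/
def delta (m : ℕ) : DihedralArtin m := alt false m

/-- The Garside generators: the nonempty alternating products of length less than `m`,
together with `Δ`. -/
def garside (m : ℕ) : Set (DihedralArtin m) :=
  {g | ∃ (s : Bool) (n : ℕ), 1 ≤ n ∧ n < m ∧ g = alt s n} ∪ {delta m}

/-! ### The complex

For every `g` there is a precell `Π_g`: the circuit of length `2m` in the Cayley graph with initial
vertex `g`, terminal vertex `gΔ`, and two half boundaries `j ↦ g * alt s j`, `0 ≤ j ≤ m`. -/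

/-- Vertices of the complex: the real vertices are the elements of the group, and every precell
`Π_g` has `m - 2` interior vertices, placed in positions `1, …, m - 2` of its axis. -/
inductive Vert (m : ℕ) : Type
  | real (g : DihedralArtin m) : Vert m
  | inner (g : DihedralArtin m) (i : Set.Ioo 0 (m - 1)) : Vert m

noncomputable instance : DecidableEq (Vert m) := Classical.decEq _

/-- The group acts on real vertices and on precells by left multiplication. -/
instance : MulAction (DihedralArtin m) (Vert m) where
  smul h v := match v with
    | .real g => .real (h * g)
    | .inner g i => .inner (h * g) i
  one_smul v := by
    cases v with
    | real g => exact congrArg Vert.real (one_mul g)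
    | inner g i => exact congrArg (Vert.inner · i) (one_mul g)
  mul_smul x y v := by
    cases v with
    | real g => exact congrArg Vert.real (mul_assoc x y g)
    | inner g i => exact congrArg (Vert.inner · i) (mul_assoc x y g)

/-- The vertex in position `j` of a half boundary of the precell `Π_g`; the half boundary is given
by its first letter `s`. -/
def halfBoundary (g : DihedralArtin m) (s : Bool) (j : ℕ) : Vert m := .real (g * alt s j)

/-- The vertex in position `i` of the axis of the precell `Π_g`, for `0 ≤ i ≤ m - 1`: the initial
vertex for `i = 0`, then the interior vertices, then the terminal vertex for `i = m - 1`. -/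
def axis (g : DihedralArtin m) (i : ℕ) : Vert m :=
  if h : i ∈ Set.Ioo 0 (m - 1) then .inner g ⟨i, h⟩
  else if i = 0 then .real g
  else .real (g * delta m)

/-- The interior edges of the precell `Π_g`: those that are added when it is triangulated.
They are the edges of the axis, and the edges that join every interior vertex, in position `i`, to
the vertices in positions `i` and `i + 1` of both half boundaries. -/
inductive InteriorEdge (g : DihedralArtin m) : Vert m → Vert m → Prop
  | along (i : ℕ) (hi : i + 1 < m) : InteriorEdge g (axis g i) (axis g (i + 1))
  | left (s : Bool) (i : ℕ) (h0 : 1 ≤ i) (hi : i + 1 < m) :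
      InteriorEdge g (axis g i) (halfBoundary g s i)
  | right (s : Bool) (i : ℕ) (h0 : 1 ≤ i) (hi : i + 1 < m) :
      InteriorEdge g (axis g i) (halfBoundary g s (i + 1))

/-- The boundaries of `Π_g` and `Π_h` overlap in a path of `k` edges, `2 ≤ k < m`, which is a final
segment of a half boundary of `Π_g` and an initial segment of a half boundary of `Π_h`. -/
def Overlap (g h : DihedralArtin m) (k : ℕ) : Prop :=
  2 ≤ k ∧ k < m ∧
    ∃ s s' : Bool, ∀ j ≤ k, halfBoundary g s (m - k + j) = halfBoundary h s' j

/-- The edges of the complex: the edges of the Cayley graph, the interior edges of the precells and,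
for each pair of precells overlapping in a path of `k ≥ 2` edges, the zigzag
`x₁ y₁ x₂ y₂ ⋯ x_{k-1} y_{k-1}` through the interior vertices on either side of that path, namely
`x_t = axis g (m - k - 1 + t)` in `Π_g` and `y_t = axis h t` in `Π_h`, for `1 ≤ t < k`. -/
inductive Edge : Vert m → Vert m → Prop
  | cayley (g : DihedralArtin m) (s : Bool) : Edge (.real g) (.real (g * gen s))
  | interior {g : DihedralArtin m} {u v : Vert m} (h : InteriorEdge g u v) : Edge u v
  | zig {g h : DihedralArtin m} {k : ℕ} (hk : Overlap g h k) (t : ℕ) (h1 : 1 ≤ t) (h2 : t < k) :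
      Edge (axis g (m - k - 1 + t)) (axis h t)
  | zag {g h : DihedralArtin m} {k : ℕ} (hk : Overlap g h k) (t : ℕ) (h1 : 1 ≤ t) (h2 : t + 1 < k) :
      Edge (axis g (m - k + t)) (axis h t)

/-- The 1-skeleton of the complex. -/
def skeleton (m : ℕ) : SimpleGraph (Vert m) := SimpleGraph.fromRel Edge

/-- The systolic complex of the dihedral Artin group: the flag complex of its 1-skeleton. -/
def systolicComplex (m : ℕ) : AbstractSimplicialComplex (Vert m) :=
  GroupComplex.flagComplex (skeleton m)

/-- The base vertex: the identity vertex of the Cayley graph. -/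
def base (m : ℕ) : Vert m := .real 1

/-- A set `V₀` of simplices is based on the precell `Π₀` with initial vertex `v₀`: it contains `v₀`
and the two real edges of `Π₀` through `v₀`; it contains all interior vertices and interior edges of
`Π₀`; and each of its simplices contains `v₀` or an interior vertex of `Π₀`. -/
structure IsBased (V₀ : Set (Finset (Vert m))) : Prop where
  base_mem : {base m} ∈ V₀
  real_edge_mem : ∀ s : Bool, {base m, Vert.real (gen s)} ∈ V₀
  inner_mem : ∀ i, {Vert.inner 1 i} ∈ V₀
  interior_edge_mem : ∀ u v : Vert m, InteriorEdge 1 u v → {u, v} ∈ V₀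
  meets : ∀ σ ∈ V₀, base m ∈ σ ∨ ∃ i, Vert.inner 1 i ∈ σ

end DihedralArtin

namespace GroupComplex

variable {V : Type*} [DecidableEq V] {G : Type*} [Group G] [MulAction G V]

/-! Everything is read off from the equivariant map `corner`, which sends a real vertex to itself
and an interior vertex of `Π_g` to `g`. Upper bound: the corners of two adjacent vertices differ by
an element of `symmGarside` (`Edge.corner_mem`). A representative in a based `V₀` has a vertex with
corner `1`, so every label of a simplex is the corner of one of its vertices
(`IsBased.exists_corner_eq`). Labels of two faces of one simplex therefore differ by an element of
`symmGarside`. Lower bound: a Garside generator `g`, as a vertex of `Π₀`, ends an edge of `V₀` whose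
other endpoint `u` is also in `V₀` (`IsBased.exists_edge`). Both `{u}` and the edge have label `1`,
and `{g}` has label `g`, so `g` lies in `𝒜` and in `ℬ`. Both alphabets are closed under inversion.
-/

theorem one_mem_labels {V₀ : Set (Finset V)} {σ : Finset V} (h : σ ∈ V₀) :
    (1 : G) ∈ labels G V₀ σ :=
  ⟨σ, h, (one_smul G σ).symm⟩

theorem mem_pairLabels_of_one_mem {V₀ : Set (Finset V)} {σ τ : Finset V} {g : G}
    (hσ : σ ∈ V₀) (hτ : g ∈ labels G V₀ τ) : g ∈ pairLabels G V₀ σ τ :=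
  Set.mem_mul.2 ⟨1, by simpa using one_mem_labels hσ, g, hτ, one_mul g⟩

theorem inv_mem_pairLabels {V₀ : Set (Finset V)} {σ τ : Finset V} {g : G}
    (h : g ∈ pairLabels G V₀ σ τ) : g⁻¹ ∈ pairLabels G V₀ τ σ := by
  obtain ⟨x, hx, y, hy, rfl⟩ := Set.mem_mul.1 h
  exact Set.mem_mul.2 ⟨y⁻¹, by simpa using hy, x⁻¹, hx, by simp⟩

theorem inv_mem_alphabetA {X : AbstractSimplicialComplex V} {V₀ : Set (Finset V)} {v₀ : V} {g : G}
    (h : g ∈ alphabetA G X V₀ v₀) : g⁻¹ ∈ alphabetA G X V₀ v₀ := by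
  rcases h with h | ⟨ρ, hρ, τ, hτ, hd, hu, h⟩
  · exact Or.inl (inv_smul_eq_iff.2 (Eq.symm h))
  · exact Or.inr ⟨τ, hτ, ρ, hρ, hd.symm, by rwa [Finset.union_comm], inv_mem_pairLabels h⟩

theorem inv_mem_alphabetB {X : AbstractSimplicialComplex V} {V₀ : Set (Finset V)} {v₀ : V} {g : G}
    (h : g ∈ alphabetB G X V₀ v₀) : g⁻¹ ∈ alphabetB G X V₀ v₀ := by
  rcases h with h | ⟨σ, hσ, τ, hτ, hi, h⟩
  · exact Or.inl (inv_smul_eq_iff.2 (Eq.symm h))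
  · exact Or.inr ⟨τ, hτ, σ, hσ, hi.symm, inv_mem_pairLabels h⟩

/-- Two distinct vertices spanning an edge contribute their pair labels to `𝒜`. -/
theorem mem_alphabetA_of_edge {X : AbstractSimplicialComplex V} {V₀ : Set (Finset V)} {v₀ u v : V}
    {g : G} (huv : {u, v} ∈ X.faces) (hne : u ≠ v) (hu : {u} ∈ V₀)
    (hv : g ∈ labels G V₀ {v}) : g ∈ alphabetA G X V₀ v₀ :=
  Or.inr ⟨{u}, X.singleton_mem u, {v}, X.singleton_mem v, by simpa using hne, huv,
    mem_pairLabels_of_one_mem hu hv⟩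

/-- The labels of an endpoint of an edge in `V₀` lie in `ℬ`. -/
theorem mem_alphabetB_of_edge {X : AbstractSimplicialComplex V} {V₀ : Set (Finset V)} {v₀ u v : V}
    {g : G} (huv : {u, v} ∈ X.faces) (h₀ : {u, v} ∈ V₀)
    (hv : g ∈ labels G V₀ {v}) : g ∈ alphabetB G X V₀ v₀ :=
  Or.inr ⟨{u, v}, huv, {v}, X.singleton_mem v, Or.inr (by simp), mem_pairLabels_of_one_mem h₀ hv⟩

end GroupComplex

namespace DihedralArtin

open GroupComplex

variable {m : ℕ}

/-! ### Alternating products and Garside generators -/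

theorem map_altProd {M N : Type*} [Monoid M] [Monoid N] (f : M →* N) (x y : M) (n : ℕ) :
    f (altProd x y n) = altProd (f x) (f y) n := by
  induction n generalizing x y with
  | zero => exact map_one f
  | succ n ih => rw [altProd, map_mul, ih, altProd]

theorem alt_self (s : Bool) : (alt s m : DihedralArtin m) = delta m := by
  cases s with
  | false => rfl
  | true =>
    have h := PresentedGroup.mk_eq_mk_of_mul_inv_mem (rels := {altProd (FreeGroup.of false)
      (FreeGroup.of true) m * (altProd (FreeGroup.of true) (FreeGroup.of false) m)⁻¹})
      (Set.mem_singleton _)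
    rw [map_altProd, map_altProd] at h
    exact h.symm

/-- The Garside generators, their inverses, and the identity. -/
def symmGarside (m : ℕ) : Set (DihedralArtin m) := garside m ∪ (garside m)⁻¹ ∪ {1}

theorem inv_mem_symmGarside {g : DihedralArtin m} (h : g ∈ symmGarside m) :
    g⁻¹ ∈ symmGarside m := by
  rcases h with (h | h) | h
  · exact Or.inl (Or.inr (by simpa using h))
  · exact Or.inl (Or.inl h)
  · exact Or.inr (by simpa using h)

theorem one_mem_symmGarside : (1 : DihedralArtin m) ∈ symmGarside m := Or.inr rfl

theorem alt_mem_symmGarside (s : Bool) {j : ℕ} (hj : j ≤ m) : alt s j ∈ symmGarside m := by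
  rcases Nat.eq_zero_or_pos j with rfl | h0
  · exact one_mem_symmGarside
  · rcases hj.lt_or_eq with h | rfl
    · exact Or.inl (Or.inl (Or.inl ⟨s, j, h0, h, rfl⟩))
    · rw [alt_self]
      exact Or.inl (Or.inl (Or.inr rfl))

/-! ### Corners, and the upper bound for the alphabets -/

/-- A real vertex, or the initial vertex of the precell containing a given interior vertex. -/
def corner : Vert m → DihedralArtin m
  | .real g => g
  | .inner g _ => g

theorem corner_smul (h : DihedralArtin m) (v : Vert m) : corner (h • v) = h * corner v := by
  cases v <;> rfl

theorem axis_of_mem (g : DihedralArtin m) {i : ℕ} (hi : i ∈ Set.Ioo 0 (m - 1)) :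
    axis g i = .inner g ⟨i, hi⟩ := dif_pos hi

theorem axis_zero (g : DihedralArtin m) : axis g 0 = .real g := by
  simp [axis]

theorem axis_last (hm : 2 ≤ m) (g : DihedralArtin m) : axis g (m - 1) = .real (g * delta m) := by
  have h : m - 1 ≠ 0 := by omega
  simp [axis, h]

/-- The bound excludes only the terminal position `m - 1`, where the corner is `gΔ`. -/
theorem corner_axis {i : ℕ} (g : DihedralArtin m) (hi : i + 1 < m) : corner (axis g i) = g := by
  rcases Nat.eq_zero_or_pos i with rfl | h0
  · rw [axis_zero]; rfl
  · rw [axis_of_mem g ⟨h0, by omega⟩]; rfl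

theorem corner_halfBoundary (g : DihedralArtin m) (s : Bool) (j : ℕ) :
    corner (halfBoundary g s j) = g * alt s j := rfl

/-- The shared path starts at the initial vertex of `Π_h`, which is position `m - k` on a half
boundary of `Π_g`. Hence the corners along a zigzag edge differ by an alternating product. -/
theorem Overlap.exists_eq {g h : DihedralArtin m} {k : ℕ} (hk : Overlap g h k) :
    ∃ s, h = g * alt s (m - k) := by
  obtain ⟨-, -, s, s', H⟩ := hk
  have h0 := congrArg corner (H 0 (Nat.zero_le k))
  refine ⟨s, ?_⟩
  rw [corner_halfBoundary, corner_halfBoundary] at h0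
  simpa [alt, altProd] using h0.symm

theorem InteriorEdge.corner_mem {g : DihedralArtin m} {u v : Vert m} (h : InteriorEdge g u v) :
    (corner u)⁻¹ * corner v ∈ symmGarside m := by
  cases h with
  | along i hi =>
    rw [corner_axis g hi]
    rcases Nat.lt_or_ge (i + 1 + 1) m with h | h
    · rw [corner_axis g h, inv_mul_cancel]
      exact one_mem_symmGarside
    -- Only the last edge of the axis changes the corner, from `g` to `gΔ`.
    · obtain rfl : i = m - 2 := by omega
      rw [show m - 2 + 1 = m - 1 by omega, axis_last (by omega), corner, inv_mul_cancel_left]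
      exact alt_mem_symmGarside false le_rfl
  | left s i h0 hi =>
    rw [corner_axis g hi, corner_halfBoundary, inv_mul_cancel_left]
    exact alt_mem_symmGarside s (by omega)
  | right s i h0 hi =>
    rw [corner_axis g hi, corner_halfBoundary, inv_mul_cancel_left]
    exact alt_mem_symmGarside s (by omega)

theorem Edge.corner_mem (hm : 2 ≤ m) {u v : Vert m} (h : Edge u v) :
    (corner u)⁻¹ * corner v ∈ symmGarside m := by
  cases h with
  | cayley g s =>
    have h1 := alt_mem_symmGarside (m := m) s (j := 1) (by omega)
    rw [corner, corner, inv_mul_cancel_left]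
    simpa [alt, altProd] using h1
  | interior h => exact h.corner_mem
  | @zig g h k hk t h1 h2 =>
    obtain ⟨s, hs⟩ := hk.exists_eq
    have hk1 := hk.2.1
    rw [corner_axis g (by omega), corner_axis h (by omega), hs, inv_mul_cancel_left]
    exact alt_mem_symmGarside s (by omega)
  | @zag g h k hk t h1 h2 =>
    obtain ⟨s, hs⟩ := hk.exists_eq
    have hk1 := hk.2.1
    rw [corner_axis g (by omega), corner_axis h (by omega), hs, inv_mul_cancel_left]
    exact alt_mem_symmGarside s (by omega)

theorem corner_mem_of_face (hm : 2 ≤ m) {σ : Finset (Vert m)}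
    (hσ : σ ∈ (systolicComplex m).faces) {u v : Vert m} (hu : u ∈ σ) (hv : v ∈ σ) :
    (corner u)⁻¹ * corner v ∈ symmGarside m := by
  rcases eq_or_ne u v with rfl | hne
  · rw [inv_mul_cancel]
    exact one_mem_symmGarside
  · rcases (hσ.2 hu hv hne).2 with h | h
    · exact h.corner_mem hm
    · simpa using inv_mem_symmGarside (h.corner_mem hm)

theorem IsBased.exists_corner_eq {V₀ : Set (Finset (Vert m))} (hb : IsBased V₀)
    {σ : Finset (Vert m)} {g : DihedralArtin m} (h : g ∈ labels (DihedralArtin m) V₀ σ) :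
    ∃ u ∈ σ, corner u = g := by
  obtain ⟨τ, hτ, rfl⟩ := h
  have key : ∃ u ∈ τ, corner u = 1 := by
    rcases hb.meets τ hτ with h | ⟨i, h⟩
    · exact ⟨_, h, rfl⟩
    · exact ⟨_, h, rfl⟩
  obtain ⟨u, hu, h1⟩ := key
  exact ⟨g • u, Finset.smul_mem_smul_finset hu, by rw [corner_smul, h1, mul_one]⟩

/-- Serves both alphabets: `ω` is the spanned simplex `ρ ∪ τ` for `𝒜`, and the larger of the two
simplices for `ℬ`. -/
theorem IsBased.pairLabels_subset (hm : 2 ≤ m) {V₀ : Set (Finset (Vert m))} (hb : IsBased V₀)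
    {σ τ ω : Finset (Vert m)} (hω : ω ∈ (systolicComplex m).faces) (hσ : σ ⊆ ω) (hτ : τ ⊆ ω) :
    pairLabels (DihedralArtin m) V₀ σ τ ⊆ symmGarside m := by
  rintro _ ⟨x, hx, y, hy, rfl⟩
  obtain ⟨u, hu, hux⟩ := hb.exists_corner_eq (Set.mem_inv.1 hx)
  obtain ⟨v, hv, rfl⟩ := hb.exists_corner_eq hy
  have h := corner_mem_of_face hm hω (hσ hu) (hτ hv)
  rwa [hux, inv_inv] at h

theorem smul_base (g : DihedralArtin m) : g • base m = .real g :=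
  congrArg Vert.real (mul_one g)

theorem eq_one_of_smul_base {g : DihedralArtin m} (h : g • base m = base m) : g = 1 := by
  rw [smul_base] at h
  exact Vert.real.inj h

theorem IsBased.alphabetA_subset (hm : 2 ≤ m) {V₀ : Set (Finset (Vert m))} (hb : IsBased V₀) :
    alphabetA (DihedralArtin m) (systolicComplex m) V₀ (base m) ⊆ symmGarside m := by
  rintro g (h | ⟨ρ, -, τ, -, -, hu, h⟩)
  · exact Or.inr (eq_one_of_smul_base h)
  · exact hb.pairLabels_subset hm hu Finset.subset_union_left Finset.subset_union_right h

theorem IsBased.alphabetB_subset (hm : 2 ≤ m) {V₀ : Set (Finset (Vert m))} (hb : IsBased V₀) :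
    alphabetB (DihedralArtin m) (systolicComplex m) V₀ (base m) ⊆ symmGarside m := by
  rintro g (h | ⟨σ, hσ, τ, hτ, hi | hi, h⟩)
  · exact Or.inr (eq_one_of_smul_base h)
  · exact hb.pairLabels_subset hm hτ hi subset_rfl h
  · exact hb.pairLabels_subset hm hσ subset_rfl hi h

/-! ### The lower bound for the alphabets -/

theorem IsBased.mem_labels_real {V₀ : Set (Finset (Vert m))} (hb : IsBased V₀)
    (g : DihedralArtin m) : g ∈ labels (DihedralArtin m) V₀ {Vert.real g} :=
  ⟨{base m}, hb.base_mem, by rw [Finset.smul_finset_singleton, smul_base]⟩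

theorem IsBased.axis_mem {V₀ : Set (Finset (Vert m))} (hb : IsBased V₀) {i : ℕ} (hi : i + 1 < m) :
    {axis 1 i} ∈ V₀ := by
  rcases Nat.eq_zero_or_pos i with rfl | h0
  · rw [axis_zero]; exact hb.base_mem
  · rw [axis_of_mem 1 ⟨h0, by omega⟩]; exact hb.inner_mem _

/-- The homomorphism to the integers that sends both standard generators to `1`. -/
def length (m : ℕ) : DihedralArtin m →* Multiplicative ℤ :=
  PresentedGroup.toGroup (f := fun _ => Multiplicative.ofAdd 1) (by
    rintro _ rfl
    simp [map_altProd])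

theorem length_alt (s : Bool) (n : ℕ) :
    length m (alt s n) = Multiplicative.ofAdd (n : ℤ) := by
  have key : ∀ x : Multiplicative ℤ, altProd x x n = x ^ n := fun x => by
    induction n with
    | zero => rw [altProd, pow_zero]
    | succ n ih => rw [altProd, ih, pow_succ']
  rw [alt, map_altProd]
  simp only [length, gen, PresentedGroup.toGroup.of]
  rw [key, ← ofAdd_nsmul]
  simp

/-- Both sides of the relation have `m` letters, so word length is a homomorphism to `ℤ` and detects
positive words. This keeps the edges used below nondegenerate, as the disjointness in `𝒜` requires.
-/
theorem alt_ne_one (s : Bool) {n : ℕ} (hn : 1 ≤ n) : (alt s n : DihedralArtin m) ≠ 1 := by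
  intro h
  have h1 := congrArg (length m) h
  rw [length_alt, map_one, ofAdd_eq_one] at h1
  omega

/-- Every Garside generator, as a vertex of `Π₀`, is joined by an edge in `V₀` to `v₀` or to an
interior vertex of `Π₀`. -/
theorem IsBased.exists_edge (hm : 2 ≤ m) {V₀ : Set (Finset (Vert m))} (hb : IsBased V₀)
    {g : DihedralArtin m} (hg : g ∈ garside m) :
    ∃ u : Vert m, {u} ∈ V₀ ∧ {u, Vert.real g} ∈ V₀ ∧ u ≠ Vert.real g := by
  have axis_ne (s : Bool) {i n : ℕ} (hi : i + 1 < m) (hn : 1 ≤ n) :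
      axis (m := m) 1 i ≠ Vert.real (alt s n) := by
    rcases Nat.eq_zero_or_pos i with rfl | h0
    · rw [axis_zero]
      exact fun h => alt_ne_one s hn (Vert.real.inj h).symm
    · rw [axis_of_mem 1 ⟨h0, by omega⟩]
      exact fun h => by cases h
  rcases hg with ⟨s, n, h1, hn, rfl⟩ | rfl
  · rcases Nat.lt_or_ge (n + 1) m with h | h
    · refine ⟨axis 1 n, hb.axis_mem h, hb.interior_edge_mem _ _ ?_, axis_ne s h h1⟩
      simpa [halfBoundary] using InteriorEdge.left (g := 1) s n h1 h
    -- Here `n = m - 1`, which is not an interior axis position. If `n = 1` then `m = 2`, there are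
    -- no interior vertices, and a real edge at `v₀` is needed; otherwise the interior vertex in
    -- position `m - 2` is joined to position `m - 1`.
    · rcases Nat.eq_or_lt_of_le h1 with rfl | h2
      · refine ⟨base m, hb.base_mem, ?_, ?_⟩
        · simpa [alt, altProd] using hb.real_edge_mem s
        · exact fun h => alt_ne_one s le_rfl (Vert.real.inj h).symm
      · obtain ⟨i, rfl⟩ : ∃ i, n = i + 1 := ⟨n - 1, by omega⟩
        refine ⟨axis 1 i, hb.axis_mem hn, hb.interior_edge_mem _ _ ?_, axis_ne s hn h1⟩
        simpa [halfBoundary] using InteriorEdge.right (g := 1) s i (by omega) hn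
  -- `Δ` is reached by the last axis edge, which starts at `v₀` itself when `m = 2`.
  · refine ⟨axis 1 (m - 2), hb.axis_mem (by omega), hb.interior_edge_mem _ _ ?_,
      axis_ne false (by omega) (by omega)⟩
    have h := InteriorEdge.along (m := m) (g := 1) (m - 2) (by omega)
    rwa [show m - 2 + 1 = m - 1 by omega, axis_last hm, one_mul] at h

theorem symmGarside_subset_of_inv {S : Set (DihedralArtin m)} (h1 : 1 ∈ S)
    (hinv : ∀ g ∈ S, g⁻¹ ∈ S) (hS : garside m ⊆ S) : symmGarside m ⊆ S := by
  rintro g ((h | h) | rfl)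
  · exact hS h
  · simpa using hinv _ (hS h)
  · exact h1

theorem IsBased.alphabetA_eq (hm : 2 ≤ m) {V₀ : Set (Finset (Vert m))} (hb : IsBased V₀)
    (hsub : V₀ ⊆ (systolicComplex m).faces) :
    alphabetA (DihedralArtin m) (systolicComplex m) V₀ (base m) = symmGarside m := by
  refine (hb.alphabetA_subset hm).antisymm (symmGarside_subset_of_inv
    (Or.inl (one_smul _ _)) (fun _ => inv_mem_alphabetA) fun g hg => ?_)
  obtain ⟨u, hu, huv, hne⟩ := hb.exists_edge hm hg
  exact mem_alphabetA_of_edge (hsub huv) hne hu (hb.mem_labels_real g)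

theorem IsBased.alphabetB_eq (hm : 2 ≤ m) {V₀ : Set (Finset (Vert m))} (hb : IsBased V₀)
    (hsub : V₀ ⊆ (systolicComplex m).faces) :
    alphabetB (DihedralArtin m) (systolicComplex m) V₀ (base m) = symmGarside m := by
  refine (hb.alphabetB_subset hm).antisymm (symmGarside_subset_of_inv
    (Or.inl (one_smul _ _)) (fun _ => inv_mem_alphabetB) fun g hg => ?_)
  obtain ⟨u, hu, huv, hne⟩ := hb.exists_edge hm hg
  exact mem_alphabetB_of_edge (hsub huv) huv (hb.mem_labels_real g)

end DihedralArtin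

theorem mainTheorem2 (m : ℕ) (hm : 2 ≤ m) (V₀ : Set (Finset (DihedralArtin.Vert m)))
    (hreps : GroupComplex.IsOrbitReps (DihedralArtin m) (DihedralArtin.systolicComplex m) V₀)
    (hbased : DihedralArtin.IsBased V₀) :
    GroupComplex.alphabetA (DihedralArtin m) (DihedralArtin.systolicComplex m) V₀
        (DihedralArtin.base m) =
      DihedralArtin.garside m ∪ (DihedralArtin.garside m)⁻¹ ∪ {1} ∧
    GroupComplex.alphabetB (DihedralArtin m) (DihedralArtin.systolicComplex m) V₀
        (DihedralArtin.base m) =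
      DihedralArtin.garside m ∪ (DihedralArtin.garside m)⁻¹ ∪ {1} :=
  ⟨hbased.alphabetA_eq hm hreps.subset, hbased.alphabetB_eq hm hreps.subset⟩
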